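/- Let $n\ge 1$ and let $S^n\subset\mathbb{R}^{n+1}$ be the standard unit sphere with north pole $p_0=(1,0,\dots,0)$. For $k\ge 0$ let $\mathcal{H}^n_k$ be the space of real spherical harmonics of degree $k$ on $S^n$, i.e. the restrictions to $S^n$ of homogeneous harmonic polynomials of degree $k$ in $n+1$ real variables. For a function $Y$ on $S^n$, the connected components of $\{Y\neq 0\}$ are called the nodal domains of $Y$. There exist constants $c_{1,n}>0$ and $c_{2,n}>0$, depending only on $n$, and a sequence $(Y^n_k)_{k\ge 1}$ with $Y^n_k\in\mathcal{H}^n_k$ such that for every $k\ge 1$: 1. the number of nodal domains of $Y^n_k$ is at least $c_{1,n}k^n$; 2. at least $c_{2,n}k^{n-1}$ nodal domains of $Y^n_k$ have the north pole $p_0$ on their boundary. -/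

import Mathlib

open scoped ENNReal

noncomputable section

namespace SphereNodal

/-- The ambient Euclidean space `ℝ^{n+1}` of the sphere `S^n`. -/
abbrev Ambient (n : ℕ) : Type := EuclideanSpace ℝ (Fin (n + 1))

/-- The standard unit sphere `S^n ⊆ ℝ^{n+1}`. -/
abbrev Sph (n : ℕ) : Type := Metric.sphere (0 : Ambient n) 1

/-- The Laplacian `∑ ∂²/∂xᵢ²` on real polynomials in `n + 1` variables. -/
def polyLaplacian (n : ℕ) :
    MvPolynomial (Fin (n + 1)) ℝ →ₗ[ℝ] MvPolynomial (Fin (n + 1)) ℝ :=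
  ∑ i : Fin (n + 1),
    (MvPolynomial.pderiv i).toLinearMap ∘ₗ (MvPolynomial.pderiv i).toLinearMap

/-- The real polynomials in `n + 1` variables that are homogeneous of degree `k` and harmonic. -/
def harmonicPolynomials (n k : ℕ) : Submodule ℝ (MvPolynomial (Fin (n + 1)) ℝ) :=
  MvPolynomial.homogeneousSubmodule (Fin (n + 1)) ℝ k ⊓ LinearMap.ker (polyLaplacian n)

/-- Restriction of a polynomial to the sphere, as a real function on `S^n`. -/
def restrictToSphere (n : ℕ) : MvPolynomial (Fin (n + 1)) ℝ →ₗ[ℝ] (Sph n → ℝ) where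
  toFun p := fun x => MvPolynomial.eval (fun i => (x : Ambient n) i) p
  map_add' p q := by ext x; simp
  map_smul' a p := by ext x; simp

/-- The space of (real) spherical harmonics of degree `k` on `S^n`: restrictions to the sphere of
homogeneous harmonic polynomials of degree `k` in `n + 1` variables. -/
def sphericalHarmonics (n k : ℕ) : Submodule ℝ (Sph n → ℝ) :=
  (harmonicPolynomials n k).map (restrictToSphere n)

/-- The nodal domains of `f`: the connected components of the set `{f ≠ 0}`. -/
def nodalDomains {X : Type*} [TopologicalSpace X] (f : X → ℝ) : Set (Set X) :=
  {Ω | ∃ x ∈ {y | f y ≠ 0}, Ω = connectedComponentIn {y | f y ≠ 0} x}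

/-- The north pole `(1, 0, …, 0)` of `S^n`. -/
def northPole (n : ℕ) : Sph n :=
  ⟨EuclideanSpace.single 0 1, by simp⟩

end SphereNodal

end

/-! The proof is by induction on the dimension, with the equator as the lower sphere. Write a point
of `ℝ^{n+2}` as `(x₀, x')`. A harmonic `P(x')` of degree `j ≥ 1` is raised `m` times by `F ↦ (2 deg
F + n) x₀ F - |x|² ∂₀ F`, which keeps harmonicity (`raise_mem_harmonicPolynomials`). Away from the
poles the result separates as `|x'|^(m+j) · P(x'/|x'|) · q(x₀/|x'|)` with `q = profile n j m`
(`restrictToSphere_raise`), and it vanishes at the poles.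

A Rolle argument, including the two ends at infinity, shows that each raising adds a sign change to
`q` (`Alternates.raise`), so `q` takes `m + 1` alternating signs. Nodal domains of the product are
then at least `m + 1` times those of `P` (`NodalProduct.mul_encard_le`). Beyond the last zero of
`q`, each nodal domain of `P` gives a separate one reaching the pole
(`NodalProduct.encard_le_encard_frontier`).

Splitting `k = m + j` into near halves, the domains of `P`, of order `k^(dim - 1)`, give both
bounds. -/

noncomputable section

namespace SphereNodal

/-! ### Harmonic polynomials by raising in the zeroth variable -/

open MvPolynomial in
/-- The square of the Euclidean norm, as a polynomial. -/
def normSqPoly (n : ℕ) : MvPolynomial (Fin (n + 1)) ℝ := ∑ i, X i ^ 2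

open MvPolynomial in
lemma normSqPoly_isHomogeneous (n : ℕ) : (normSqPoly n).IsHomogeneous 2 :=
  IsHomogeneous.sum _ _ _ fun i _ => isHomogeneous_X_pow i 2

open MvPolynomial in
lemma pderiv_normSqPoly (n : ℕ) (i : Fin (n + 1)) :
    pderiv i (normSqPoly n) = 2 * X i := by
  classical
  simp [normSqPoly, pderiv_X, Pi.single_apply]

open MvPolynomial in
lemma polyLaplacian_apply (n : ℕ) (F : MvPolynomial (Fin (n + 1)) ℝ) :
    polyLaplacian n F = ∑ i, pderiv i (pderiv i F) := by
  simp [polyLaplacian]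

open MvPolynomial in
lemma polyLaplacian_C_mul (n : ℕ) (a : ℝ) (F : MvPolynomial (Fin (n + 1)) ℝ) :
    polyLaplacian n (C a * F) = C a * polyLaplacian n F := by
  rw [← smul_eq_C_mul, map_smul, smul_eq_C_mul]

open MvPolynomial in
lemma polyLaplacian_X_mul (n : ℕ) (i : Fin (n + 1)) (F : MvPolynomial (Fin (n + 1)) ℝ) :
    polyLaplacian n (X i * F) = 2 * pderiv i F + X i * polyLaplacian n F := by
  classical
  have h : ∀ l, pderiv l (pderiv l (X i * F)) =
      (if l = i then 2 * pderiv i F else 0) + X i * pderiv l (pderiv l F) := by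
    intro l
    by_cases hl : l = i
    · subst hl
      simp [pderiv_X]
      ring
    · simp [pderiv_X, hl]
  simp only [polyLaplacian_apply, h, Finset.sum_add_distrib, Finset.mul_sum]
  simp

-- The cross term `4 ∑ xₗ ∂ₗ F` is `4 d F` by Euler's identity.
open MvPolynomial in
lemma polyLaplacian_normSqPoly_mul (n d : ℕ) {F : MvPolynomial (Fin (n + 1)) ℝ}
    (hF : F.IsHomogeneous d) :
    polyLaplacian n (normSqPoly n * F) =
      C (2 * (n + 1) + 4 * d : ℝ) * F + normSqPoly n * polyLaplacian n F := by
  have h : ∀ l, pderiv l (pderiv l (normSqPoly n * F)) =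
      2 * F + 4 * (X l * pderiv l F) + normSqPoly n * pderiv l (pderiv l F) := by
    intro l
    have h2 : pderiv l (2 : MvPolynomial (Fin (n + 1)) ℝ) = 0 := Derivation.map_natCast _ 2
    simp [pderiv_normSqPoly, h2]
    ring
  simp only [polyLaplacian_apply, h, Finset.sum_add_distrib, ← Finset.mul_sum,
    hF.sum_X_mul_pderiv]
  simp only [Finset.sum_const, Finset.card_univ, Fintype.card_fin, nsmul_eq_mul, map_add, map_mul,
    map_natCast, map_one, map_ofNat]
  push_cast
  ring

open MvPolynomial in
lemma pderiv_polyLaplacian (n : ℕ) (i : Fin (n + 1)) (F : MvPolynomial (Fin (n + 1)) ℝ) :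
    polyLaplacian n (pderiv i F) = pderiv i (polyLaplacian n F) := by
  have hc : ∀ l G, pderiv l (pderiv i G) = pderiv i (pderiv l (G : MvPolynomial (Fin (n + 1)) ℝ)) := by
    classical
    intro l G
    -- Partial derivatives commute because their bracket is a derivation that kills every variable.
    let D (i : Fin (n + 1)) :
      Derivation ℝ (MvPolynomial (Fin (n + 1)) ℝ) (MvPolynomial (Fin (n + 1)) ℝ) := pderiv i
    have h : ⁅D l, D i⁆ = 0 := by
      refine derivation_ext fun k => ?_
      simp [D, Derivation.commutator_apply, pderiv_X, Pi.single_apply, apply_ite]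
    have h' := congrArg (fun D => D G) h
    simpa [D, Derivation.commutator_apply, sub_eq_zero] using h'
  simp [polyLaplacian_apply, hc]

open MvPolynomial in
lemma pderiv_zero_rename_succ (n : ℕ) (P : MvPolynomial (Fin (n + 1)) ℝ) :
    pderiv 0 (rename Fin.succ P) = 0 := by
  refine pderiv_eq_zero_of_notMem_vars fun h => ?_
  classical
  obtain ⟨i, -, hi⟩ := Finset.mem_image.1 (vars_rename _ _ h)
  exact Fin.succ_ne_zero _ hi

open MvPolynomial in
lemma polyLaplacian_rename_succ (n : ℕ) (P : MvPolynomial (Fin (n + 1)) ℝ) :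
    polyLaplacian (n + 1) (rename Fin.succ P) = rename Fin.succ (polyLaplacian n P) := by
  simp only [polyLaplacian_apply, Fin.sum_univ_succ (n := n + 1), pderiv_zero_rename_succ, map_zero,
    zero_add, pderiv_rename (Fin.succ_injective _), map_sum]

open MvPolynomial in
/-- The harmonic polynomials obtained from a harmonic polynomial `P` of degree `j`, independent of
the zeroth variable, by `m` applications of the conformal raising operator
`F ↦ (2 deg F + n) x₀ F - |x|² ∂₀ F`. -/
def raise (n j : ℕ) (P : MvPolynomial (Fin (n + 1)) ℝ) : ℕ → MvPolynomial (Fin (n + 2)) ℝ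
  | 0 => rename Fin.succ P
  | m + 1 => C (2 * (m + j) + n : ℝ) * (X 0 * raise n j P m)
      - normSqPoly (n + 1) * pderiv 0 (raise n j P m)

-- For `F` harmonic of degree `d = m + j` in `n + 2` variables, `Δ(x₀ F) = 2 ∂₀F` and `Δ(|x|² ∂₀F) =
-- (2(n+2) + 4(d-1)) ∂₀F = 2(2d+n) ∂₀F`, so the coefficient `2d + n` makes them cancel.
open MvPolynomial in
lemma raise_mem_harmonicPolynomials {n j : ℕ} (hj : 1 ≤ j) {P : MvPolynomial (Fin (n + 1)) ℝ}
    (hP : P ∈ harmonicPolynomials n j) (m : ℕ) :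
    raise n j P m ∈ harmonicPolynomials (n + 1) (m + j) := by
  induction m with
  | zero =>
    refine ⟨?_, ?_⟩
    · simpa [raise] using IsHomogeneous.rename_isHomogeneous (f := Fin.succ) hP.1
    · have := LinearMap.mem_ker.1 hP.2
      simp [raise, polyLaplacian_rename_succ, this]
  | succ m ih =>
    have h1 : (raise n j P m).IsHomogeneous (m + j) := ih.1
    have h2 : polyLaplacian (n + 1) (raise n j P m) = 0 := ih.2
    have h3 := h1.pderiv (i := 0)
    refine ⟨?_, ?_⟩
    · refine Submodule.sub_mem _ ?_ ?_
      · have h := ((isHomogeneous_X ℝ 0).mul h1).C_mul (2 * (m + j) + n : ℝ)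
        rwa [show 1 + (m + j) = m + 1 + j by omega] at h
      · have h := (normSqPoly_isHomogeneous (n + 1)).mul h3
        rwa [show 2 + (m + j - 1) = m + 1 + j by omega] at h
    · change polyLaplacian (n + 1) _ = 0
      rw [raise, map_sub, polyLaplacian_C_mul, polyLaplacian_X_mul,
        polyLaplacian_normSqPoly_mul _ _ h3, pderiv_polyLaplacian, h2]
      push_cast [Nat.cast_sub (show 1 ≤ m + j by omega)]
      simp only [map_zero, map_add, map_mul, mul_zero, add_zero, map_sub, map_one]
      simp only [map_ofNat]
      ring

-- This factor forces vanishing on the polar axis, where `x' = 0`.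
open MvPolynomial in
lemma rename_dvd_raise (n j : ℕ) (P : MvPolynomial (Fin (n + 1)) ℝ) (m : ℕ) :
    rename Fin.succ P ∣ raise n j P m := by
  induction m with
  | zero => exact dvd_rfl
  | succ m ih =>
    obtain ⟨G, hG⟩ := ih
    refine dvd_sub (Dvd.dvd.mul_left (Dvd.dvd.mul_left ⟨G, hG⟩ _) _) (Dvd.dvd.mul_left ?_ _)
    rw [hG, Derivation.leibniz, pderiv_zero_rename_succ]
    simp

/-! ### The one-variable profile and separation of variables -/

open Polynomial in
/-- The profile of `raise n j P m` along the zeroth coordinate. -/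
def profile (n j : ℕ) : ℕ → ℝ[X]
  | 0 => 1
  | m + 1 => C ((2 * (m + j) + n : ℕ) : ℝ) * X * profile n j m
      - (1 + X ^ 2) * derivative (profile n j m)

open Polynomial in
lemma natDegree_profile_le (n j m : ℕ) : (profile n j m).natDegree ≤ m := by
  induction m with
  | zero => simp [profile]
  | succ m ih =>
    rw [profile]
    refine (natDegree_sub_le _ _).trans (max_le ?_ ?_)
    · rw [mul_assoc]
      refine (natDegree_C_mul_le _ _).trans (natDegree_mul_le.trans ?_)
      simp only [natDegree_X]
      omega
    · rcases m with _ | m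
      · simp [profile]
      · refine natDegree_mul_le.trans ?_
        have h1 : (1 + X ^ 2 : ℝ[X]).natDegree ≤ 2 := by compute_degree
        have h2 := natDegree_derivative_le (profile n j (m + 1))
        omega

/-- Restriction of a polynomial to the line parallel to the zeroth axis through `(0, y)`. -/
def lineRestrict (n : ℕ) (y : Fin (n + 1) → ℝ) :
    MvPolynomial (Fin (n + 2)) ℝ →ₐ[ℝ] Polynomial ℝ :=
  MvPolynomial.aeval (Fin.cons Polynomial.X fun i => Polynomial.C (y i))

lemma eval_lineRestrict (n : ℕ) (y : Fin (n + 1) → ℝ) (t : ℝ)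
    (p : MvPolynomial (Fin (n + 2)) ℝ) :
    (lineRestrict n y p).eval t = MvPolynomial.eval (Fin.cons t y) p := by
  induction p using MvPolynomial.induction_on with
  | C a => simp [lineRestrict]
  | add p q hp hq => simp [hp, hq]
  | mul_X p i hp =>
    rw [map_mul, Polynomial.eval_mul, hp, map_mul]
    refine Fin.cases ?_ (fun i => ?_) i <;> simp [lineRestrict]

lemma derivative_lineRestrict (n : ℕ) (y : Fin (n + 1) → ℝ) (p : MvPolynomial (Fin (n + 2)) ℝ) :
    Polynomial.derivative (lineRestrict n y p) = lineRestrict n y (MvPolynomial.pderiv 0 p) := by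
  induction p using MvPolynomial.induction_on with
  | C a => simp [lineRestrict]
  | add p q hp hq => simp [hp, hq]
  | mul_X p i hp =>
    rw [map_mul, Polynomial.derivative_mul, hp, Derivation.leibniz]
    refine Fin.cases ?_ (fun i => ?_) i
    · simp [lineRestrict]
      ring
    · simp [lineRestrict]
      ring

/-- On the line over a unit vector `y` one has `|x|² = 1 + t²` and `∂₀ = d/dt`, so both recursions
agree. -/
lemma lineRestrict_raise (n j : ℕ) (P : MvPolynomial (Fin (n + 1)) ℝ) {y : Fin (n + 1) → ℝ}
    (hy : ∑ i, y i ^ 2 = 1) (m : ℕ) :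
    lineRestrict n y (raise n j P m) =
      Polynomial.C (MvPolynomial.eval y P) * profile n j m := by
  induction m with
  | zero =>
    refine Polynomial.funext fun t => ?_
    rw [eval_lineRestrict]
    simp [raise, profile, MvPolynomial.eval_rename, Function.comp_def]
  | succ m ih =>
    have hX : lineRestrict n y (MvPolynomial.X 0) = Polynomial.X := by simp [lineRestrict]
    have hN : lineRestrict n y (normSqPoly (n + 1)) = 1 + Polynomial.X ^ 2 := by
      rw [normSqPoly, Fin.sum_univ_succ]
      simp only [map_add, map_pow, map_sum, hX]
      rw [add_comm, ← Polynomial.C_1, ← hy]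
      simp [lineRestrict]
    have hC : ∀ a : ℝ, lineRestrict n y (MvPolynomial.C a) = Polynomial.C a := by
      intro a; simp [lineRestrict]
    rw [raise, profile, map_sub, map_mul, map_mul, map_mul, hX, hN, hC,
      ← derivative_lineRestrict, ih, Polynomial.derivative_mul, Polynomial.derivative_C]
    push_cast
    ring

end SphereNodal
end

/-! ### Sign changes of the profile -/

noncomputable section

namespace SphereNodal

open Filter Topology Polynomial

/-- `q` takes nonzero values of alternating signs at `m + 1` increasing points. -/
def Alternates (q : ℝ → ℝ) (m : ℕ) : Prop :=
  ∃ (u : ℕ → ℝ) (ε : ℝ), (∀ i < m, u i < u (i + 1)) ∧ ∀ i ≤ m, 0 < ε * (-1) ^ i * q (u i)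

/-- With `c = 2(m + j) + n` the bracket is the profile recursion: raising is, up to a negative
factor, differentiation of a weighted profile. -/
lemma hasDerivAt_weighted (q : ℝ[X]) (c : ℕ) (t : ℝ) :
    HasDerivAt (fun t => q.eval t / √(1 + t ^ 2) ^ c)
      (-((C (c : ℝ) * X * q - (1 + X ^ 2) * derivative q).eval t) / √(1 + t ^ 2) ^ (c + 2)) t := by
  have hp : 0 < 1 + t ^ 2 := by positivity
  have hs : √(1 + t ^ 2) ^ 2 = 1 + t ^ 2 := Real.sq_sqrt hp.le
  have hs0 : 0 < √(1 + t ^ 2) := Real.sqrt_pos.2 hp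
  have h1 : HasDerivAt (fun t : ℝ => 1 + t ^ 2) (2 * t) t := by
    simpa using (hasDerivAt_pow 2 t).const_add 1
  have h2 := (h1.sqrt hp.ne').pow c
  have h3 := (q.hasDerivAt t).div h2 (pow_pos hs0 c).ne'
  refine h3.congr_deriv ?_
  simp only [eval_sub, eval_mul, eval_C, eval_X, eval_add, eval_one, eval_pow, Pi.pow_apply]
  rw [← hs, Real.sqrt_sq hs0.le]
  generalize √(1 + t ^ 2) = r at hs0
  rcases c with _ | c
  · simp
    field_simp
  · rw [Nat.add_sub_cancel]
    field_simp
    ring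

lemma tendsto_weighted_atTop {q : ℝ[X]} {c : ℕ} (h : q.natDegree < c) :
    Tendsto (fun t => q.eval t / √(1 + t ^ 2) ^ c) atTop (𝓝 0) := by
  have hd : (1 + X ^ 2 : ℝ[X]).natDegree = 2 := by compute_degree!
  -- Squaring removes the root and reduces the limit to a rational function.
  have hdeg : (q ^ 2).degree < ((1 + X ^ 2 : ℝ[X]) ^ c).degree := by
    apply degree_lt_degree
    rw [natDegree_pow, natDegree_pow, hd]
    omega
  have h1 := (div_tendsto_atTop_zero_of_degree_lt _ _ hdeg).sqrt
  rw [Real.sqrt_zero] at h1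
  rw [tendsto_zero_iff_abs_tendsto_zero]
  refine h1.congr fun t => ?_
  have hp : 0 ≤ 1 + t ^ 2 := by positivity
  rw [Function.comp_apply, ← Real.sqrt_sq_eq_abs, div_pow, ← pow_mul, mul_comm c 2, pow_mul,
    Real.sq_sqrt hp]
  simp

lemma tendsto_weighted_atBot {q : ℝ[X]} {c : ℕ} (h : q.natDegree < c) :
    Tendsto (fun t => q.eval t / √(1 + t ^ 2) ^ c) atBot (𝓝 0) := by
  have h' : (q.comp (-X)).natDegree < c := by
    rwa [natDegree_comp, natDegree_neg, natDegree_X, mul_one]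
  refine ((tendsto_weighted_atTop h').comp tendsto_neg_atBot_atTop).congr fun t => ?_
  simp

lemma Alternates.raise {q : ℝ[X]} {m c : ℕ} (hq : Alternates q.eval m)
    (hc : q.natDegree < c) :
    Alternates (C (c : ℝ) * X * q - (1 + X ^ 2) * derivative q).eval (m + 1) := by
  obtain ⟨u, ε, hu, hs⟩ := hq
  set f : ℝ → ℝ := fun t => q.eval t / √(1 + t ^ 2) ^ c with hf
  have hw : ∀ t : ℝ, 0 < √(1 + t ^ 2) := fun t => Real.sqrt_pos.2 (by positivity)
  have hsf : ∀ i ≤ m, 0 < ε * (-1) ^ i * f (u i) := by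
    intro i hi
    rw [hf, mul_div_assoc']
    exact div_pos (hs i hi) (pow_pos (hw _) _)
  obtain ⟨a, ha, hau⟩ : ∃ a, ε * f a < ε * f (u 0) ∧ a < u 0 := by
    have h0 := (tendsto_weighted_atBot hc).const_mul ε
    rw [mul_zero] at h0
    have h1 := hsf 0 (Nat.zero_le _)
    rw [pow_zero, mul_one] at h1
    exact ((h0.eventually_lt_const h1).and (eventually_lt_atBot _)).exists
  obtain ⟨b, hb, hub⟩ : ∃ b, ε * (-1) ^ m * f b < ε * (-1) ^ m * f (u m) ∧ u m < b := by
    have h0 := (tendsto_weighted_atTop hc).const_mul (ε * (-1) ^ m)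
    rw [mul_zero] at h0
    exact ((h0.eventually_lt_const (hsf m le_rfl)).and (eventually_gt_atTop _)).exists
  -- Since `f` decays at both ends, far points `a` and `b` extend the `m + 1` alternation points to
  -- `m + 3`, giving `m + 2` intervals on which the mean slope of `f` alternates in sign.
  let w : ℕ → ℝ := fun i => if i = 0 then a else if i ≤ m + 1 then u (i - 1) else b
  have hw0 : w 0 = a := rfl
  have hw1 : ∀ i ≤ m, w (i + 1) = u i := by
    intro i hi
    simp [w, hi]
  have hw2 : w (m + 2) = b := by simp [w]
  have hstep : ∀ i ≤ m + 1, w i < w (i + 1) ∧ ε * (-1) ^ i * f (w i) < ε * (-1) ^ i * f (w (i + 1)) := by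
    intro i hi
    rcases i with _ | i
    · rw [hw0, hw1 0 (Nat.zero_le _)]
      exact ⟨hau, by simpa using ha⟩
    · rcases (show i ≤ m by omega).eq_or_lt with rfl | hlt
      · rw [hw1 i le_rfl, hw2]
        refine ⟨hub, ?_⟩
        rw [pow_succ]
        linarith
      · rw [hw1 i hlt.le, hw1 (i + 1) hlt]
        refine ⟨hu i hlt, ?_⟩
        have h1 := hsf i hlt.le
        have h2 := hsf (i + 1) hlt
        rw [pow_succ] at h2 ⊢
        linarith
  have hmvt : ∀ i, ∃ v, i ≤ m + 1 → w i < v ∧ v < w (i + 1) ∧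
      0 < -ε * (-1) ^ i * (C (c : ℝ) * X * q - (1 + X ^ 2) * derivative q).eval v := by
    intro i
    by_cases hi : i ≤ m + 1
    swap
    · exact ⟨0, fun h => absurd h hi⟩
    obtain ⟨h1, h2⟩ := hstep i hi
    obtain ⟨v, hv, hve⟩ := exists_hasDerivAt_eq_slope f _ h1
      (fun t _ => (hasDerivAt_weighted q c t).continuousAt.continuousWithinAt)
      (fun t _ => hasDerivAt_weighted q c t)
    refine ⟨v, fun _ => ⟨hv.1, hv.2, ?_⟩⟩
    rw [div_eq_div_iff (pow_pos (hw v) _).ne' (sub_pos.2 h1).ne'] at hve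
    have h3 : 0 < (w (i + 1) - w i) := sub_pos.2 h1
    have h4 : 0 < √(1 + v ^ 2) ^ (c + 2) := pow_pos (hw v) _
    refine pos_of_mul_pos_left (b := w (i + 1) - w i) ?_ h3.le
    calc (0 : ℝ) < (ε * (-1) ^ i * f (w (i + 1)) - ε * (-1) ^ i * f (w i)) * √(1 + v ^ 2) ^ (c + 2) :=
          mul_pos (sub_pos.2 h2) h4
      _ = _ := by linear_combination (-(ε * (-1) ^ i)) * hve
  choose v hv using hmvt
  -- The sign flips because the derivative of `f` is a negative multiple of the new polynomial.
  refine ⟨v, -ε, fun i hi => ?_, fun i hi => (hv i hi).2.2⟩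
  exact (hv i (by omega)).2.1.trans (hv (i + 1) (by omega)).1

lemma alternates_profile (n : ℕ) {j : ℕ} (hj : 1 ≤ j) (m : ℕ) :
    Alternates (profile n j m).eval m := by
  induction m with
  | zero => exact ⟨fun _ => 0, 1, by simp, by simp [profile]⟩
  | succ m ih =>
    refine ih.raise ?_
    have := natDegree_profile_le n j m
    omega

lemma Alternates.ne_zero {q : ℝ[X]} {m : ℕ} (hq : Alternates q.eval m) : q ≠ 0 := by
  rintro rfl
  obtain ⟨u, ε, -, hs⟩ := hq
  simpa using hs 0 (Nat.zero_le _)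

lemma exists_eval_ne_zero_of_le {q : ℝ[X]} (hq : q ≠ 0) : ∃ T : ℝ, ∀ t ≥ T, q.eval t ≠ 0 := by
  have h : ∀ᶠ t in atTop, t ∉ q.rootSet ℝ := by
    have := (q.rootSet_finite ℝ).isCompact.compl_mem_cocompact
    exact atTop_le_cocompact this
  obtain ⟨T, hT⟩ := eventually_atTop.1 h
  refine ⟨T, fun t ht h0 => hT t ht ?_⟩
  rw [mem_rootSet]
  exact ⟨hq, by simpa using h0⟩

/-- A connected set on which `q` does not vanish meets at most one of the points at which `q`
has alternating signs. -/
lemma Alternates.exists_separated {q : ℝ → ℝ} (hqc : Continuous q) {m : ℕ} (hq : Alternates q m) :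
    ∃ u : ℕ → ℝ, (∀ i ≤ m, q (u i) ≠ 0) ∧ ∀ i ≤ m, ∀ j ≤ m, ∀ s : Set ℝ, IsPreconnected s →
      (∀ t ∈ s, q t ≠ 0) → u i ∈ s → u j ∈ s → i = j := by
  obtain ⟨u, ε, hu, hs⟩ := hq
  refine ⟨u, fun i hi h => by simpa [h] using hs i hi, ?_⟩
  have hmono : ∀ i j, i ≤ j → j ≤ m → u i ≤ u j := by
    intro i j hij
    induction j, hij using Nat.le_induction with
    | base => exact fun _ => le_rfl
    | succ j hj ih => exact fun h => (ih (by omega)).trans (hu j (by omega)).le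
  have key : ∀ i j, i < j → j ≤ m → ∀ s : Set ℝ, IsPreconnected s →
      (∀ t ∈ s, q t ≠ 0) → u i ∈ s → u j ∈ s → False := by
    intro i j hij hj s hsc hne hi hjs
    have hsub : Set.Icc (u i) (u j) ⊆ s := hsc.Icc_subset hi hjs
    have h1 : u (i + 1) ∈ s := hsub ⟨(hu i (by omega)).le, hmono _ _ hij hj⟩
    have hc : ContinuousOn (fun t => ε * (-1) ^ i * q t) s := by fun_prop
    have h2 := hs i (by omega)
    have h3 := hs (i + 1) (by omega)
    rw [pow_succ] at h3
    obtain ⟨t, ht, h0⟩ := hsc.intermediate_value h1 hi hc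
      (show (0 : ℝ) ∈ Set.Icc _ _ from ⟨by linarith, h2.le⟩)
    have : ε * (-1) ^ i ≠ 0 := fun h => by simp [h] at h2
    exact hne t ht ((mul_eq_zero.1 h0).resolve_left this)
  intro i hi j hj s h1 h2 h3 h4
  rcases lt_trichotomy i j with h | h | h
  · exact (key i j h hj s h1 h2 h3 h4).elim
  · exact h
  · exact (key j i h hi s h1 h2 h4 h3).elim

end SphereNodal
end

/-! ### Nodal domains of a product -/

noncomputable section

namespace SphereNodal

open Filter Topology

lemma exists_representatives {Y : Type*} [TopologicalSpace Y] [Nonempty Y] (f : Y → ℝ) :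
    ∃ p : Set Y → Y, ∀ D ∈ nodalDomains f,
      f (p D) ≠ 0 ∧ D = connectedComponentIn {y | f y ≠ 0} (p D) := by
  have h : ∀ D : Set Y, ∃ y, D ∈ nodalDomains f →
      f y ≠ 0 ∧ D = connectedComponentIn {y | f y ≠ 0} y := by
    intro D
    by_cases hD : D ∈ nodalDomains f
    · obtain ⟨y, hy⟩ := hD
      exact ⟨y, fun _ => hy⟩
    · exact ⟨Classical.arbitrary Y, fun h => absurd h hD⟩
  exact Classical.axiomOfChoice h

/-- A partial product structure of the nonvanishing set of `g` over those of `q` and `f`. -/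
structure NodalProduct {X Y : Type*} [TopologicalSpace X] [TopologicalSpace Y]
    (g : X → ℝ) (q : ℝ → ℝ) (f : Y → ℝ) where
  height : X → ℝ
  proj : X → Y
  chart : ℝ → Y → X
  continuousOn_height : ContinuousOn height {x | g x ≠ 0}
  continuousOn_proj : ContinuousOn proj {x | g x ≠ 0}
  height_chart : ∀ t y, height (chart t y) = t
  proj_chart : ∀ t y, proj (chart t y) = y
  chart_ne : ∀ t y, q t ≠ 0 → f y ≠ 0 → g (chart t y) ≠ 0
  height_ne : ∀ x, g x ≠ 0 → q (height x) ≠ 0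
  proj_ne : ∀ x, g x ≠ 0 → f (proj x) ≠ 0

namespace NodalProduct

variable {X Y : Type*} [TopologicalSpace X] [TopologicalSpace Y]
  {g : X → ℝ} {q : ℝ → ℝ} {f : Y → ℝ}

/-- The projection maps a nodal domain of `g` onto a connected subset of `{f ≠ 0}`. -/
lemma proj_eq_of_eq (S : NodalProduct g q f) {s t : ℝ} {y z : Y}
    (ht : q t ≠ 0) (hz : f z ≠ 0) (hs : q s ≠ 0) (hy : f y ≠ 0)
    (h : connectedComponentIn {x | g x ≠ 0} (S.chart s y) =
      connectedComponentIn {x | g x ≠ 0} (S.chart t z)) :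
    connectedComponentIn {y | f y ≠ 0} y = connectedComponentIn {y | f y ≠ 0} z := by
  set K := connectedComponentIn {x | g x ≠ 0} (S.chart s y) with hK
  have hKs : K ⊆ {x | g x ≠ 0} := connectedComponentIn_subset _ _
  have h1 : S.chart s y ∈ K := mem_connectedComponentIn (S.chart_ne _ _ hs hy)
  have h2 : S.chart t z ∈ K := h ▸ mem_connectedComponentIn (S.chart_ne _ _ ht hz)
  have hc : IsPreconnected (S.proj '' K) :=
    isPreconnected_connectedComponentIn.image _ (S.continuousOn_proj.mono hKs)
  have hy' : y ∈ S.proj '' K := ⟨_, h1, S.proj_chart _ _⟩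
  have hz' : z ∈ S.proj '' K := ⟨_, h2, S.proj_chart _ _⟩
  refine connectedComponentIn_eq (hc.subset_connectedComponentIn hy' ?_ hz')
  rintro _ ⟨x, hx, rfl⟩
  exact S.proj_ne x (hKs hx)

lemma exists_connected_of_eq (S : NodalProduct g q f) {s t : ℝ} {y z : Y}
    (ht : q t ≠ 0) (hz : f z ≠ 0) (hs : q s ≠ 0) (hy : f y ≠ 0)
    (h : connectedComponentIn {x | g x ≠ 0} (S.chart s y) =
      connectedComponentIn {x | g x ≠ 0} (S.chart t z)) :
    ∃ K : Set ℝ, IsPreconnected K ∧ (∀ r ∈ K, q r ≠ 0) ∧ s ∈ K ∧ t ∈ K := by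
  set K := connectedComponentIn {x | g x ≠ 0} (S.chart s y) with hK
  have hKs : K ⊆ {x | g x ≠ 0} := connectedComponentIn_subset _ _
  have h1 : S.chart s y ∈ K := mem_connectedComponentIn (S.chart_ne _ _ hs hy)
  have h2 : S.chart t z ∈ K := h ▸ mem_connectedComponentIn (S.chart_ne _ _ ht hz)
  refine ⟨S.height '' K,
    isPreconnected_connectedComponentIn.image _ (S.continuousOn_height.mono hKs), ?_,
    ⟨_, h1, S.height_chart _ _⟩, ⟨_, h2, S.height_chart _ _⟩⟩
  rintro _ ⟨x, hx, rfl⟩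
  exact S.height_ne x (hKs hx)

lemma mul_encard_le [Nonempty Y] (S : NodalProduct g q f) (hq : Continuous q) {m : ℕ} (ha : Alternates q m) :
    ((m + 1 : ℕ) : ℕ∞) * (nodalDomains f).encard ≤ (nodalDomains g).encard := by
  obtain ⟨u, hu, hsep⟩ := ha.exists_separated hq
  obtain ⟨p, hp⟩ := exists_representatives f
  rw [← Set.Nat.encard_range, ← Set.encard_prod]
  refine Set.encard_le_encard_of_injOn
    (f := fun a : ℕ × Set Y => connectedComponentIn {x | g x ≠ 0} (S.chart (u a.1) (p a.2))) ?_ ?_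
  · rintro ⟨i, D⟩ ⟨hi, hD⟩
    exact ⟨_, S.chart_ne _ _ (hu i (Nat.lt_succ_iff.1 hi)) (hp D hD).1, rfl⟩
  · rintro ⟨i, D⟩ ⟨hi, hD⟩ ⟨j, E⟩ ⟨hj, hE⟩ h
    have hi' := Nat.lt_succ_iff.1 hi
    have hj' := Nat.lt_succ_iff.1 hj
    obtain ⟨K, h1, h2, h3, h4⟩ :=
      S.exists_connected_of_eq (hu j hj') (hp E hE).1 (hu i hi') (hp D hD).1 h
    have h5 := S.proj_eq_of_eq (hu j hj') (hp E hE).1 (hu i hi') (hp D hD).1 h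
    rw [← (hp D hD).2, ← (hp E hE).2] at h5
    exact Prod.ext (hsep i hi' j hj' K h1 h2 h3 h4) h5

lemma encard_le_encard_frontier [Nonempty Y] (S : NodalProduct g q f) {T : ℝ} (hT : ∀ t ≥ T, q t ≠ 0) {a : X}
    (ha : g a = 0) (hcont : ∀ y, Continuous fun t => S.chart t y)
    (hlim : ∀ y, Tendsto (fun t => S.chart t y) atTop (𝓝 a)) :
    (nodalDomains f).encard ≤ {Ω ∈ nodalDomains g | a ∈ frontier Ω}.encard := by
  obtain ⟨p, hp⟩ := exists_representatives f
  refine Set.encard_le_encard_of_injOn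
    (f := fun D => connectedComponentIn {x | g x ≠ 0} (S.chart T (p D))) ?_ ?_
  · intro D hD
    refine ⟨⟨_, S.chart_ne _ _ (hT T le_rfl) (hp D hD).1, rfl⟩, ?_, ?_⟩
    -- The chart ray over `[T, ∞)` avoids the zeros of `g`, so it stays in one nodal domain while
    -- tending to `a`.
    · refine mem_closure_of_tendsto (hlim (p D)) ((eventually_ge_atTop T).mono fun t ht => ?_)
      have hc : IsPreconnected ((fun t => S.chart t (p D)) '' Set.Ici T) :=
        isPreconnected_Ici.image _ (hcont _).continuousOn
      refine hc.subset_connectedComponentIn ⟨T, Set.self_mem_Ici, rfl⟩ ?_ ⟨t, ht, rfl⟩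
      rintro _ ⟨r, hr, rfl⟩
      exact S.chart_ne _ _ (hT r hr) (hp D hD).1
    · exact fun h => connectedComponentIn_subset _ _ (interior_subset h) ha
  · intro D hD E hE h
    have h5 := S.proj_eq_of_eq (hT T le_rfl) (hp E hE).1 (hT T le_rfl) (hp D hD).1 h
    rwa [← (hp D hD).2, ← (hp E hE).2] at h5

end NodalProduct
end SphereNodal
end

/-! ### The product structure on the sphere -/

noncomputable section

namespace SphereNodal

open Filter Topology

/-- The projection of `ℝ^{n+2}` along the zeroth axis. -/
def tail (n : ℕ) (x : Ambient (n + 1)) : Ambient n := WithLp.toLp 2 fun i => x i.succ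

@[simp] lemma tail_apply (n : ℕ) (x : Ambient (n + 1)) (i : Fin (n + 1)) :
    tail n x i = x i.succ := rfl

lemma continuous_tail (n : ℕ) : Continuous (tail n) := by
  unfold tail
  fun_prop

lemma sum_sq_eq_one (n : ℕ) (y : Sph n) : ∑ i, (y : Ambient n) i ^ 2 = 1 := by
  have h := norm_eq_of_mem_sphere y
  rw [EuclideanSpace.norm_eq, Real.sqrt_eq_one] at h
  simpa using h

/-- The point of `S^{n+1}` on the meridian of `y ∈ S^n` at which `x₀ = t |x'|`. -/
def meridian (n : ℕ) (t : ℝ) (y : Sph n) : Sph (n + 1) :=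
  ⟨WithLp.toLp 2 (Fin.cons (t / √(1 + t ^ 2)) fun i => (y : Ambient n) i / √(1 + t ^ 2)), by
    have h : 0 < 1 + t ^ 2 := by positivity
    rw [mem_sphere_zero_iff_norm, EuclideanSpace.norm_eq, Real.sqrt_eq_one, Fin.sum_univ_succ]
    simp only [Fin.cons_zero, Fin.cons_succ, Real.norm_eq_abs, sq_abs, div_pow,
      Real.sq_sqrt h.le, ← Finset.sum_div, sum_sq_eq_one]
    field_simp
    ring⟩

@[simp] lemma meridian_zero (n : ℕ) (t : ℝ) (y : Sph n) :
    (meridian n t y : Ambient (n + 1)) 0 = t / √(1 + t ^ 2) := rfl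

lemma tail_meridian (n : ℕ) (t : ℝ) (y : Sph n) :
    tail n (meridian n t y) = (√(1 + t ^ 2))⁻¹ • (y : Ambient n) := by
  ext i
  simp [meridian, div_eq_inv_mul]

lemma norm_tail_meridian (n : ℕ) (t : ℝ) (y : Sph n) :
    ‖tail n (meridian n t y)‖ = (√(1 + t ^ 2))⁻¹ := by
  rw [tail_meridian, norm_smul, norm_eq_of_mem_sphere y, mul_one, Real.norm_of_nonneg]
  positivity

open Classical in
/-- The nearest-point projection of `S^{n+1}` minus its poles to the equator, with an arbitrary
value at the poles. -/
def equatorProj (n : ℕ) (x : Sph (n + 1)) : Sph n :=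
  if h : tail n x = 0 then northPole n
  else ⟨‖tail n x‖⁻¹ • tail n x, by
    rw [mem_sphere_zero_iff_norm, norm_smul, norm_inv, norm_norm,
      inv_mul_cancel₀ (norm_ne_zero_iff.2 h)]⟩

lemma coe_equatorProj {n : ℕ} {x : Sph (n + 1)} (h : tail n x ≠ 0) :
    (equatorProj n x : Ambient n) = ‖tail n x‖⁻¹ • tail n x := by
  rw [equatorProj, dif_neg h]

lemma continuousOn_equatorProj (n : ℕ) :
    ContinuousOn (equatorProj n) {x | tail n x ≠ 0} := by
  rw [Topology.IsInducing.subtypeVal.continuousOn_iff]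
  have hc : Continuous fun x : Sph (n + 1) => tail n x :=
    (continuous_tail n).comp continuous_subtype_val
  have h : ContinuousOn (fun x : Sph (n + 1) => ‖tail n x‖⁻¹ • tail n x) {x | tail n x ≠ 0} :=
    (hc.norm.continuousOn.inv₀ fun x hx => norm_ne_zero_iff.2 hx).smul hc.continuousOn
  exact h.congr fun x hx => coe_equatorProj hx

lemma equatorProj_meridian (n : ℕ) (t : ℝ) (y : Sph n) :
    equatorProj n (meridian n t y) = y := by
  have hs : 0 < √(1 + t ^ 2) := Real.sqrt_pos.2 (by positivity)
  have h : tail n (meridian n t y) ≠ 0 := by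
    rw [← norm_ne_zero_iff, norm_tail_meridian]
    positivity
  apply Subtype.ext
  rw [coe_equatorProj h, norm_tail_meridian, tail_meridian, smul_smul, inv_inv,
    mul_inv_cancel₀ hs.ne', one_smul]

lemma eval_smul_of_isHomogeneous {σ : Type*} {d : ℕ} {p : MvPolynomial σ ℝ}
    (hp : p.IsHomogeneous d) (r : ℝ) (x : σ → ℝ) :
    MvPolynomial.eval (fun i => r * x i) p = r ^ d * MvPolynomial.eval x p := by
  rw [MvPolynomial.eval_eq, MvPolynomial.eval_eq, Finset.mul_sum]
  refine Finset.sum_congr rfl fun s hs => ?_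
  have h : ∑ i ∈ s.support, s i = d := (hp.degree_eq_sum_deg_support hs).symm
  simp only [mul_pow, Finset.prod_mul_distrib, Finset.prod_pow_eq_pow_sum, h]
  ring

lemma restrictToSphere_raise_eq_zero (n : ℕ) {j : ℕ} (hj : 1 ≤ j)
    {P : MvPolynomial (Fin (n + 1)) ℝ} (hP : P.IsHomogeneous j) (m : ℕ) {x : Sph (n + 1)}
    (hx : tail n x = 0) : restrictToSphere (n + 1) (raise n j P m) x = 0 := by
  obtain ⟨G, hG⟩ := rename_dvd_raise n j P m
  have h0 : ∀ i : Fin (n + 1), (x : Ambient (n + 1)) i.succ = 0 := fun i => by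
    rw [← tail_apply, hx]; rfl
  have h1 : MvPolynomial.eval (fun _ => 0) P = 0 := by
    simpa [show j ≠ 0 by omega] using eval_smul_of_isHomogeneous hP 0 (fun _ => 0)
  change MvPolynomial.eval _ _ = 0
  rw [hG, map_mul, MvPolynomial.eval_rename]
  simp only [Function.comp_def, h0, h1, zero_mul]

lemma restrictToSphere_raise (n : ℕ) {j : ℕ} (hj : 1 ≤ j)
    {P : MvPolynomial (Fin (n + 1)) ℝ} (hP : P ∈ harmonicPolynomials n j) (m : ℕ)
    {x : Sph (n + 1)} (hx : tail n x ≠ 0) :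
    restrictToSphere (n + 1) (raise n j P m) x = ‖tail n x‖ ^ (m + j) *
      (restrictToSphere n P (equatorProj n x) *
        (profile n j m).eval ((x : Ambient (n + 1)) 0 / ‖tail n x‖)) := by
  have hr : ‖tail n x‖ ≠ 0 := norm_ne_zero_iff.2 hx
  have h1 := lineRestrict_raise n j P (sum_sq_eq_one n (equatorProj n x)) m
  have h2 := congrArg (Polynomial.eval ((x : Ambient (n + 1)) 0 / ‖tail n x‖)) h1
  rw [eval_lineRestrict, Polynomial.eval_mul, Polynomial.eval_C] at h2
  change MvPolynomial.eval _ _ = _ * (MvPolynomial.eval _ _ * _)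
  rw [← h2, ← eval_smul_of_isHomogeneous (raise_mem_harmonicPolynomials hj hP m).1]
  congr 2
  ext i
  refine Fin.cases ?_ (fun i => ?_) i
  · simp [mul_div_cancel₀ _ hr]
  · simp [coe_equatorProj hx, mul_inv_cancel_left₀ hr]

/-- The nonvanishing set of `raise n j P m` on `S^{n+1}` is a product. -/
def raiseNodalProduct (n : ℕ) {j : ℕ} (hj : 1 ≤ j) {P : MvPolynomial (Fin (n + 1)) ℝ}
    (hP : P ∈ harmonicPolynomials n j) (m : ℕ) :
    NodalProduct (restrictToSphere (n + 1) (raise n j P m)) (profile n j m).eval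
      (restrictToSphere n P) :=
  have hne : ∀ x : Sph (n + 1), restrictToSphere (n + 1) (raise n j P m) x ≠ 0 →
      tail n x ≠ 0 := fun x hx h => hx (restrictToSphere_raise_eq_zero n hj hP.1 m h)
  have hheight : ∀ t y, (meridian n t y : Ambient (n + 1)) 0 / ‖tail n (meridian n t y)‖ = t := by
    intro t y
    have hs : 0 < √(1 + t ^ 2) := Real.sqrt_pos.2 (by positivity)
    rw [norm_tail_meridian, meridian_zero]
    field_simp
  { height := fun x => (x : Ambient (n + 1)) 0 / ‖tail n x‖
    proj := equatorProj n
    chart := meridian n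
    continuousOn_height := by
      have hc : Continuous fun x : Sph (n + 1) => tail n x :=
        (continuous_tail n).comp continuous_subtype_val
      have h0 : Continuous fun x : Sph (n + 1) => (x : Ambient (n + 1)) 0 := by fun_prop
      exact h0.continuousOn.div hc.norm.continuousOn fun x hx => norm_ne_zero_iff.2 (hne x hx)
    continuousOn_proj := (continuousOn_equatorProj n).mono hne
    height_chart := hheight
    proj_chart := equatorProj_meridian n
    chart_ne := by
      intro t y ht hy
      have h : ‖tail n (meridian n t y)‖ ≠ 0 := by
        have hs : 0 < √(1 + t ^ 2) := Real.sqrt_pos.2 (by positivity)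
        rw [norm_tail_meridian]
        positivity
      rw [restrictToSphere_raise n hj hP m (norm_ne_zero_iff.1 h), hheight, equatorProj_meridian]
      exact mul_ne_zero (pow_ne_zero _ h) (mul_ne_zero hy ht)
    height_ne := by
      intro x hx h
      rw [restrictToSphere_raise n hj hP m (hne x hx), h] at hx
      simp at hx
    proj_ne := by
      intro x hx h
      rw [restrictToSphere_raise n hj hP m (hne x hx), h] at hx
      simp at hx }

lemma mul_encard_nodalDomains_le_raise (n : ℕ) {j : ℕ} (hj : 1 ≤ j)
    {P : MvPolynomial (Fin (n + 1)) ℝ} (hP : P ∈ harmonicPolynomials n j) (m : ℕ) :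
    ((m + 1 : ℕ) : ℕ∞) * (nodalDomains (restrictToSphere n P)).encard ≤
      (nodalDomains (restrictToSphere (n + 1) (raise n j P m))).encard :=
  have : Nonempty (Sph n) := ⟨northPole n⟩
  (raiseNodalProduct n hj hP m).mul_encard_le (profile n j m).continuous
    (alternates_profile n hj m)

lemma tail_northPole (n : ℕ) : tail n (northPole (n + 1)) = 0 := by
  ext i
  simp [northPole]

lemma continuous_meridian (n : ℕ) (y : Sph n) : Continuous fun t => meridian n t y := by
  have hs : ∀ t : ℝ, √(1 + t ^ 2) ≠ 0 := fun t => (Real.sqrt_pos.2 (by positivity)).ne'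
  refine Continuous.subtype_mk ((PiLp.continuous_toLp 2 _).comp (continuous_pi fun i => ?_)) _
  refine Fin.cases ?_ (fun i => ?_) i
  · exact continuous_id.div (by fun_prop) hs
  · exact continuous_const.div (by fun_prop) hs

lemma tendsto_meridian (n : ℕ) (y : Sph n) :
    Tendsto (fun t => meridian n t y) atTop (𝓝 (northPole (n + 1))) := by
  have hsq : Tendsto (fun t : ℝ => √(1 + t ^ 2)) atTop atTop :=
    tendsto_atTop_mono (fun t => Real.le_sqrt_of_sq_le (by simp)) tendsto_id
  have hinv : Tendsto (fun t : ℝ => (√(1 + t ^ 2))⁻¹) atTop (𝓝 0) := hsq.inv_tendsto_atTop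
  have h0 : Tendsto (fun t : ℝ => t / √(1 + t ^ 2)) atTop (𝓝 1) := by
    have h1 : Tendsto (fun t : ℝ => √(1 - ((√(1 + t ^ 2))⁻¹) ^ 2)) atTop (𝓝 1) := by
      have h := ((hinv.pow 2).const_sub 1).sqrt
      simpa using h
    refine h1.congr' ((eventually_ge_atTop 0).mono fun t ht => ?_)
    have hp : 0 < 1 + t ^ 2 := by positivity
    have h2 : 1 - ((√(1 + t ^ 2))⁻¹) ^ 2 = (t / √(1 + t ^ 2)) ^ 2 := by
      rw [inv_pow, div_pow, Real.sq_sqrt hp.le]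
      field_simp
      ring
    rw [h2, Real.sqrt_sq (by positivity)]
  rw [tendsto_subtype_rng]
  have hp : ((northPole (n + 1) : Sph (n + 1)) : Ambient (n + 1)) =
      WithLp.toLp 2 (Fin.cons 1 fun _ => 0) := by
    ext i
    refine Fin.cases ?_ (fun i => ?_) i <;> simp [northPole]
  rw [hp]
  refine ((PiLp.continuous_toLp 2 _).tendsto _).comp (tendsto_pi_nhds.2 fun i => ?_)
  refine Fin.cases ?_ (fun i => ?_) i
  · simpa using h0
  · simpa [div_eq_mul_inv] using hinv.const_mul ((y : Ambient n) i)

lemma encard_nodalDomains_le_frontier_raise (n : ℕ) {j : ℕ} (hj : 1 ≤ j)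
    {P : MvPolynomial (Fin (n + 1)) ℝ} (hP : P ∈ harmonicPolynomials n j) (m : ℕ) :
    (nodalDomains (restrictToSphere n P)).encard ≤
      {Ω ∈ nodalDomains (restrictToSphere (n + 1) (raise n j P m)) |
        northPole (n + 1) ∈ frontier Ω}.encard := by
  have : Nonempty (Sph n) := ⟨northPole n⟩
  obtain ⟨T, hT⟩ := exists_eval_ne_zero_of_le (alternates_profile n hj m).ne_zero
  exact (raiseNodalProduct n hj hP m).encard_le_encard_frontier hT
    (restrictToSphere_raise_eq_zero n hj hP.1 m (tail_northPole n))
    (continuous_meridian n) (tendsto_meridian n)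

/-! ### The induction on dimension -/

lemma X_mem_harmonicPolynomials : (MvPolynomial.X 0) ∈ harmonicPolynomials 0 1 := by
  refine ⟨MvPolynomial.isHomogeneous_X ℝ 0, ?_⟩
  change polyLaplacian 0 _ = 0
  simp [polyLaplacian_apply]

lemma one_le_encard_nodalDomains_X :
    1 ≤ (nodalDomains (restrictToSphere 0 (MvPolynomial.X 0))).encard := by
  rw [Set.one_le_encard_iff_nonempty]
  refine ⟨_, northPole 0, ?_, rfl⟩
  simp [restrictToSphere, northPole]

/-- In every dimension there are harmonic polynomials with many nodal domains on the sphere, many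
of them adjacent to the north pole. -/
theorem exists_harmonicPolynomials (n : ℕ) :
    ∃ c : ℝ, 0 < c ∧ ∀ k : ℕ, 1 ≤ k → ∃ P ∈ harmonicPolynomials (n + 1) k,
      ENNReal.ofReal (c * (k : ℝ) ^ (n + 1)) ≤
        ((nodalDomains (restrictToSphere (n + 1) P)).encard : ℝ≥0∞) ∧
      ENNReal.ofReal (c * (k : ℝ) ^ n) ≤
        (({Ω ∈ nodalDomains (restrictToSphere (n + 1) P) |
          northPole (n + 1) ∈ frontier Ω}).encard : ℝ≥0∞) := by
  induction n with
  | zero =>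
    -- The circle is reached from `x₀` on the two-point sphere `S⁰`; counting just one nodal domain
    -- there suffices.
    refine ⟨1, one_pos, fun k hk => ⟨raise 0 1 (MvPolynomial.X 0) (k - 1), ?_, ?_, ?_⟩⟩
    · have h := raise_mem_harmonicPolynomials le_rfl X_mem_harmonicPolynomials (k - 1)
      rwa [Nat.sub_add_cancel hk] at h
    · have h := mul_encard_nodalDomains_le_raise 0 le_rfl X_mem_harmonicPolynomials (k - 1)
      rw [Nat.sub_add_cancel hk] at h
      have h' := (le_mul_of_one_le_right (zero_le) one_le_encard_nodalDomains_X).trans h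
      have h'' := ENat.toENNReal_le.2 h'
      simpa using h''
    · have h := one_le_encard_nodalDomains_X.trans
        (encard_nodalDomains_le_frontier_raise 0 le_rfl X_mem_harmonicPolynomials (k - 1))
      have h'' := ENat.toENNReal_le.2 h
      simpa using h''
  | succ n ih =>
    obtain ⟨c, hc, ih⟩ := ih
    -- The nodal count is at least `(k/2) · c (k/2)^(n+1)`, which fixes this constant; the polar
    -- count would allow `c / 2^(n+1)`.
    refine ⟨c / 2 ^ (n + 2), by positivity, fun k hk => ?_⟩
    have hj : 1 ≤ k - k / 2 := by omega
    -- Only the total nodal count of `P` is needed; its polar count plays no role.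
    obtain ⟨P, hP, hcard, -⟩ := ih (k - k / 2) hj
    have hjk : (k : ℝ) / 2 ≤ ((k - k / 2 : ℕ) : ℝ) := by
      have : k ≤ 2 * (k - k / 2) := by omega
      have : (k : ℝ) ≤ 2 * ((k - k / 2 : ℕ) : ℝ) := by exact_mod_cast this
      linarith
    have hmk : (k : ℝ) / 2 ≤ ((k / 2 + 1 : ℕ) : ℝ) := by
      have : k ≤ 2 * (k / 2 + 1) := by omega
      have : (k : ℝ) ≤ 2 * ((k / 2 + 1 : ℕ) : ℝ) := by exact_mod_cast this
      linarith
    have hcard' : c * ((k : ℝ) / 2) ^ (n + 1) ≤ c * ((k - k / 2 : ℕ) : ℝ) ^ (n + 1) := by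
      gcongr
    refine ⟨raise (n + 1) (k - k / 2) P (k / 2), ?_, ?_, ?_⟩
    · have h := raise_mem_harmonicPolynomials hj hP (k / 2)
      rwa [show k / 2 + (k - k / 2) = k by omega] at h
    · have h := ENat.toENNReal_le.2 (mul_encard_nodalDomains_le_raise (n + 1) hj hP (k / 2))
      rw [ENat.toENNReal_mul, ENat.toENNReal_coe] at h
      refine le_trans ?_ h
      refine le_trans ?_ (mul_le_mul_right hcard _)
      rw [← ENNReal.ofReal_natCast, ← ENNReal.ofReal_mul (by positivity)]
      refine ENNReal.ofReal_le_ofReal ?_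
      calc c / 2 ^ (n + 2) * (k : ℝ) ^ (n + 1 + 1) =
            (k : ℝ) / 2 * (c * ((k : ℝ) / 2) ^ (n + 1)) := by
              rw [div_pow]
              field_simp
              ring
        _ ≤ _ := by gcongr
    · refine le_trans (ENNReal.ofReal_le_ofReal ?_) (hcard.trans (ENat.toENNReal_le.2
        (encard_nodalDomains_le_frontier_raise (n + 1) hj hP (k / 2))))
      refine le_trans ?_ hcard'
      rw [div_pow, div_mul_eq_mul_div, mul_div_assoc', pow_succ 2 (n + 1)]
      gcongr
      exact le_mul_of_one_le_right (by positivity) one_le_two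

end SphereNodal
end

theorem mainTheorem8 (n : ℕ) (hn : 1 ≤ n) :
    ∃ c₁ c₂ : ℝ, 0 < c₁ ∧ 0 < c₂ ∧
      ∃ Y : ℕ → SphereNodal.Sph n → ℝ, ∀ k : ℕ, 1 ≤ k →
        Y k ∈ SphereNodal.sphericalHarmonics n k ∧
        ENNReal.ofReal (c₁ * (k : ℝ) ^ n) ≤
          ((SphereNodal.nodalDomains (Y k)).encard : ℝ≥0∞) ∧
        ENNReal.ofReal (c₂ * (k : ℝ) ^ (n - 1)) ≤
          (({Ω ∈ SphereNodal.nodalDomains (Y k) |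
              SphereNodal.northPole n ∈ frontier Ω}).encard : ℝ≥0∞) := by
  obtain ⟨n, rfl⟩ := Nat.exists_eq_add_of_le' hn
  obtain ⟨c, hc, h⟩ := SphereNodal.exists_harmonicPolynomials n
  choose! P hP h1 h2 using h
  exact ⟨c, c, hc, hc, fun k => SphereNodal.restrictToSphere (n + 1) (P k),
    fun k hk => ⟨⟨P k, hP k hk, rfl⟩, h1 k hk, h2 k hk⟩⟩
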